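/- Let $\rho>0$ be a real number and $N\ge 1$ an integer, and let $\mathcal X$ be a complex Hilbert space. An $N$-tuple $\widetilde{\mathbf A}=(\widetilde A_1,\dots,\widetilde A_N)$ of bounded linear operators on a Hilbert space $\widetilde{\mathcal X}\supset\mathcal X$ is called a unitary $\rho$-dilation of an $N$-tuple $\mathbf A=(A_1,\dots,A_N)$ of bounded linear operators on $\mathcal X$ if $$\Big(\sum_{k=1}^N z_kA_k\Big)^n=\rho\,P_{\mathcal X}\Big(\sum_{k=1}^N z_k\widetilde A_k\Big)^n\Big|_{\mathcal X}\qquad\text{for all } z\in\mathbb C^N,\ n=1,2,3,\dots,$$ where $P_{\mathcal X}$ is the orthogonal projection of $\widetilde{\mathcal X}$ onto $\mathcal X$, and if $\sum_{k=1}^N\zeta_k\widetilde A_k$ is unitary for every $\zeta\in\mathbb C^N$ with $|\zeta_1|=\dots=|\zeta_N|=1$. Let $C_{\rho,N}$ be the class of all $N$-tuples that admit a unitary $\rho$-dilation, and let $\mathcal C^N$ be the family of all $N$-tuples $\mathbf C=(C_1,\dots,C_N)$ of commuting bounded linear operators on a common complex Hilbert space $\mathcal H_{\mathbf C}$ with $\|C_k\|<1$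 for all $k$. Let $\mathbf A\otimes\mathbf C=\sum_{k=1}^N A_k\otimes C_k$, an operator on the Hilbert space tensor product $\mathcal X\otimes\mathcal H_{\mathbf C}$. Then for every $\mathbf A\in C_{\rho,N}$, every $\mathbf C\in\mathcal C^N$ and every complex polynomial $p$ of one variable, $$\|p(\mathbf A\otimes\mathbf C)\|\le\max_{|z|\le 1}\,\bigl|\rho\,p(z)+(1-\rho)\,p(0)\bigr| .$$ -/

import Mathlib

open scoped TensorProduct

universe u v w

noncomputable section

/-- `At` on `Xt` is a `ρ`-dilation of `A` on `X`, where `X` is regarded as a (closed) subspace of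
`Xt` through the linear isometry `V`: `A ^ n = ρ P_X At ^ n |_X` for `n = 1, 2, 3, …`.
The operator `P_X T |_X` on `X` is `V* T V`. -/
def IsRhoDilation {X Xt : Type*}
    [NormedAddCommGroup X] [InnerProductSpace ℂ X] [CompleteSpace X]
    [NormedAddCommGroup Xt] [InnerProductSpace ℂ Xt] [CompleteSpace Xt]
    (ρ : ℝ) (V : X →ₗᵢ[ℂ] Xt) (At : Xt →L[ℂ] Xt) (A : X →L[ℂ] X) : Prop :=
  ∀ n : ℕ, 1 ≤ n →
    A ^ n = (ρ : ℂ) •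
      (ContinuousLinearMap.adjoint V.toContinuousLinearMap ∘L (At ^ n) ∘L V.toContinuousLinearMap)

/-- The value `z A = ∑ k, z k • A k` at `z` of the linear pencil of the tuple `A`. -/
def pencil {X : Type*} [NormedAddCommGroup X] [InnerProductSpace ℂ X]
    {N : ℕ} (z : Fin N → ℂ) (A : Fin N → X →L[ℂ] X) : X →L[ℂ] X :=
  ∑ k, z k • A k

/-- `At` is a unitary `ρ`-dilation of the `N`-tuple `A`: for each `z ∈ ℂ^N` the operator `z At` is a
`ρ`-dilation of `z A`, and `ζ At` is unitary for each `ζ` in the `N`-torus. -/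
structure IsUnitaryRhoDilation {X Xt : Type*}
    [NormedAddCommGroup X] [InnerProductSpace ℂ X] [CompleteSpace X]
    [NormedAddCommGroup Xt] [InnerProductSpace ℂ Xt] [CompleteSpace Xt]
    {N : ℕ} (ρ : ℝ) (V : X →ₗᵢ[ℂ] Xt) (At : Fin N → Xt →L[ℂ] Xt) (A : Fin N → X →L[ℂ] X) :
    Prop where
  dilation : ∀ z : Fin N → ℂ, IsRhoDilation ρ V (pencil z At) (pencil z A)
  unitary : ∀ ζ : Fin N → ℂ, (∀ k, ‖ζ k‖ = 1) → pencil ζ At ∈ unitary (Xt →L[ℂ] Xt)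

/-- The class `C_{ρ,N}`: the `N`-tuples of operators that admit a unitary `ρ`-dilation
(on a Hilbert space living in the universe `v`). -/
def MemRhoClass {X : Type u}
    [NormedAddCommGroup X] [InnerProductSpace ℂ X] [CompleteSpace X]
    {N : ℕ} (ρ : ℝ) (A : Fin N → X →L[ℂ] X) : Prop :=
  ∃ (Xt : Type v) (_ : NormedAddCommGroup Xt) (_ : InnerProductSpace ℂ Xt) (_ : CompleteSpace Xt)
    (V : X →ₗᵢ[ℂ] Xt) (At : Fin N → Xt →L[ℂ] Xt), IsUnitaryRhoDilation ρ V At A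

/-- `C` is an `N`-tuple of commuting strict contractions. -/
structure IsCommutingStrictContraction {H : Type*} [NormedAddCommGroup H] [InnerProductSpace ℂ H]
    {N : ℕ} (C : Fin N → H →L[ℂ] H) : Prop where
  comm : ∀ k j, C k * C j = C j * C k
  norm_lt_one : ∀ k, ‖C k‖ < 1

/-- The Hilbert space tensor product: the completion of the algebraic tensor product for the inner
product with `⟪x ⊗ h, x' ⊗ h'⟫ = ⟪x, x'⟫ ⟪h, h'⟫`. -/
abbrev HilbertTensor (X H : Type*) [NormedAddCommGroup X] [InnerProductSpace ℂ X]
    [NormedAddCommGroup H] [InnerProductSpace ℂ H] : Type _ :=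
  UniformSpace.Completion (X ⊗[ℂ] H)

/-- The bounded operator `∑ k, A k ⊗ C k` on the Hilbert space tensor product. -/
def tensorTuple {X H : Type*} [NormedAddCommGroup X] [InnerProductSpace ℂ X]
    [NormedAddCommGroup H] [InnerProductSpace ℂ H]
    {N : ℕ} (A : Fin N → X →L[ℂ] X) (C : Fin N → H →L[ℂ] H) :
    HilbertTensor X H →L[ℂ] HilbertTensor X H :=
  ∑ k, (TensorProduct.mapL (A k) (C k)).completion

end

/-! ### Von Neumann's inequality via finite cyclic shifts. -/

section VonNeumann

open Polynomial

/-! Let `At` be a unitary `ρ`-dilation of `A`. Unitarity of its pencil on the torus forces the cross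
terms `star (At k) * At j`, `k ≠ j`, to vanish and `∑ k, star (At k) * At k = 1`. So the summands of
`tensorTuple At C` have orthogonal ranges, and its norm is at most `max ‖C k‖ < 1`
(`norm_tensorTuple_le`).

Because the `C k` commute, the `n`-th power of `tensorTuple A C` sees words in `A` only through
their sums over words with the same letters, which are exactly the coefficients of `(z A) ^ n`. The
dilation identity for pencils therefore transfers to the tensor products
(`tensorTuple_pow_eq_of_dilation`). Consequently `p` of `tensorTuple A C` is the compression of `q =
ρ p + (1 - ρ) p(0)` of `tensorTuple At C`, and von Neumann's inequality for this strict contraction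
bounds it by the maximum of `|q|` on the disc. -/

theorem norm_aeval_le_of_mem_unitary {A : Type*} [CStarAlgebra A] {a : A} (ha : a ∈ unitary A)
    {q : ℂ[X]} {M : ℝ} (hM : ∀ z : ℂ, ‖z‖ ≤ 1 → ‖q.eval z‖ ≤ M) : ‖aeval a q‖ ≤ M := by
  have hn : IsStarNormal a := ⟨by
    rw [commute_iff_eq, Unitary.star_mul_self_of_mem ha, Unitary.mul_star_self_of_mem ha]⟩
  rw [← cfc_polynomial q a]
  refine norm_cfc_le ((norm_nonneg _).trans (hM 0 (by simp))) fun z hz => hM z ?_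
  have := spectrum.subset_circle_of_unitary ha hz
  simp_all

variable {E : Type*} [NormedAddCommGroup E] [InnerProductSpace ℂ E]

/-- The cyclic shift `(v i) ↦ (v (i + 1))` on `E ^ (n + 1)`. -/
noncomputable def cyclicShift (E : Type*) [NormedAddCommGroup E] [InnerProductSpace ℂ E] (n : ℕ) :
    PiLp 2 (fun _ : Fin (n + 1) => E) ≃ₗᵢ[ℂ] PiLp 2 (fun _ : Fin (n + 1) => E) :=
  LinearIsometryEquiv.piLpCongrLeft 2 ℂ E (Equiv.addRight (1 : Fin (n + 1))).symm

theorem cyclicShift_apply (n : ℕ) (v : PiLp 2 (fun _ : Fin (n + 1) => E)) (i : Fin (n + 1)) :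
    cyclicShift E n v i = v (i + 1) := by
  simp [cyclicShift, LinearIsometryEquiv.piLpCongrLeft_apply, Equiv.piCongrLeft']

/-- The cyclic shift as a bounded operator. -/
noncomputable def cyclicShiftL (E : Type*) [NormedAddCommGroup E] [InnerProductSpace ℂ E] (n : ℕ) :
    PiLp 2 (fun _ : Fin (n + 1) => E) →L[ℂ] PiLp 2 (fun _ : Fin (n + 1) => E) :=
  ((cyclicShift E n).toContinuousLinearEquiv : _ →L[ℂ] _)

theorem cyclicShiftL_pow_apply (n k : ℕ) (v : PiLp 2 (fun _ : Fin (n + 1) => E))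
    (i : Fin (n + 1)) : (cyclicShiftL E n ^ k) v i = v (i + Fin.ofNat (n + 1) k) := by
  induction k generalizing i with
  | zero => simp
  | succ k ih =>
    rw [pow_succ', mul_apply_eq_comp]
    change cyclicShift E n _ i = _
    rw [cyclicShift_apply, ih]
    have : i + 1 + Fin.ofNat (n + 1) k = i + Fin.ofNat (n + 1) (k + 1) := by
      ext
      simp only [Fin.val_add, Fin.val_ofNat, Fin.coe_ofNat_eq_mod, Nat.add_mod_mod, Nat.mod_add_mod]
      rw [add_assoc, add_comm 1 k]
    rw [this]

theorem aeval_cyclicShiftL_apply {n : ℕ} (q : ℂ[X]) (v : PiLp 2 (fun _ : Fin (n + 1) => E))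
    (i : Fin (n + 1)) : aeval (cyclicShiftL E n) q v i =
      ∑ k ∈ Finset.range (q.natDegree + 1), q.coeff k • v (i + Fin.ofNat (n + 1) k) := by
  rw [aeval_eq_sum_range]
  simp only [sum_apply, smul_apply,
    WithLp.ofLp_sum, Finset.sum_apply, WithLp.ofLp_smul, Pi.smul_apply, cyclicShiftL_pow_apply]

variable [CompleteSpace E]

theorem cyclicShiftL_mem_unitary (n : ℕ) :
    cyclicShiftL E n ∈ unitary (PiLp 2 (fun _ : Fin (n + 1) => E) →L[ℂ] _) :=
  (Unitary.linearIsometryEquiv.symm (cyclicShift E n)).2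

theorem norm_aeval_cyclicShiftL_le (n : ℕ) {q : ℂ[X]} {M : ℝ}
    (hM : ∀ z : ℂ, ‖z‖ ≤ 1 → ‖q.eval z‖ ≤ M) : ‖aeval (cyclicShiftL E n) q‖ ≤ M :=
  norm_aeval_le_of_mem_unitary (cyclicShiftL_mem_unitary n) hM

/-- The witness is the positive square root of `1 - T* T`. -/
theorem exists_defect_operator {T : E →L[ℂ] E} (hT : ‖T‖ ≤ 1) :
    ∃ D : E →L[ℂ] E, ∀ x, ‖D x‖ ^ 2 = ‖x‖ ^ 2 - ‖T x‖ ^ 2 := by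
  have key (S : E →L[ℂ] E) (x : E) : RCLike.re (inner ℂ ((star S * S) x) x) = ‖S x‖ ^ 2 := by
    rw [mul_apply_eq_comp, ContinuousLinearMap.star_eq_adjoint,
      ContinuousLinearMap.adjoint_inner_left, inner_self_eq_norm_sq]
  have hval (x : E) : RCLike.re (inner ℂ ((1 - star T * T) x) x) = ‖x‖ ^ 2 - ‖T x‖ ^ 2 := by
    rw [← key T x, sub_apply, inner_sub_left, map_sub,
      one_apply_eq_self, inner_self_eq_norm_sq]
  have hpos : 0 ≤ 1 - star T * T := by
    rw [ContinuousLinearMap.nonneg_iff_isPositive, ContinuousLinearMap.isPositive_def']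
    refine ⟨(IsSelfAdjoint.one _).sub (IsSelfAdjoint.star_mul_self T), fun x => ?_⟩
    rw [ContinuousLinearMap.reApplyInnerSelf_apply, hval]
    have : ‖T x‖ ≤ ‖x‖ := by simpa using T.le_of_opNorm_le hT x
    nlinarith [norm_nonneg (T x), norm_nonneg x]
  refine ⟨CFC.sqrt (1 - star T * T), fun x => ?_⟩
  rw [← key, ← hval, (CFC.sqrt_nonneg (1 - star T * T)).isSelfAdjoint.star_eq,
    CFC.sqrt_mul_sqrt_self _ hpos]

/-- Von Neumann's inequality for strict contractions. -/
theorem norm_aeval_le_of_norm_lt_one {T : E →L[ℂ] E} (hT : ‖T‖ < 1) {q : ℂ[X]} {M : ℝ}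
    (hM : ∀ z : ℂ, ‖z‖ ≤ 1 → ‖q.eval z‖ ≤ M) : ‖aeval T q‖ ≤ M := by
  have hM0 : 0 ≤ M := (norm_nonneg _).trans (hM 0 (by simp))
  refine ContinuousLinearMap.opNorm_le_bound _ hM0 fun x => ?_
  obtain ⟨D, hD⟩ := exists_defect_operator hT.le
  set y := aeval T q x with hy
  -- The defect identity telescopes along the orbit of `z`. Thus `z ↦ (D T ^ i z)` is nearly
  -- isometric, and it turns `T` into a shift.
  have hsum (z : E) (m : ℕ) :
      ∑ i ∈ Finset.range m, ‖D ((T ^ i) z)‖ ^ 2 = ‖z‖ ^ 2 - ‖(T ^ m) z‖ ^ 2 := by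
    have := Finset.sum_range_sub' (fun i => ‖(T ^ i) z‖ ^ 2) m
    simp only [pow_zero, one_apply_eq_self] at this
    rw [← this]
    refine Finset.sum_congr rfl fun i _ => ?_
    rw [hD, pow_succ' T, mul_apply_eq_comp]
  have hbound (m : ℕ) : ‖y‖ ^ 2 - ‖(T ^ m) y‖ ^ 2 ≤ (M * ‖x‖) ^ 2 := by
    -- With this length, `i + k` with `i < m` and `k ≤ deg q` never wraps around, so the first `m`
    -- coordinates of `q` of the unitary cyclic shift agree with those coming from `q(T) x`.
    set n := m + q.natDegree with hn
    let h : PiLp 2 (fun _ : Fin (n + 1) => E) := WithLp.toLp 2 fun i => D ((T ^ (i : ℕ)) x)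
    have hh : ‖h‖ ^ 2 ≤ ‖x‖ ^ 2 := by
      rw [PiLp.norm_sq_eq_of_L2]
      change ∑ i : Fin (n + 1), ‖D ((T ^ (i : ℕ)) x)‖ ^ 2 ≤ _
      rw [Fin.sum_univ_eq_sum_range (fun i => ‖D ((T ^ i) x)‖ ^ 2), hsum]
      linarith [sq_nonneg ‖(T ^ (n + 1)) x‖]
    set g := aeval (cyclicShiftL E n) q h with hg
    have hgh : ‖g‖ ≤ M * ‖h‖ :=
      ContinuousLinearMap.le_of_opNorm_le _ (norm_aeval_cyclicShiftL_le n hM) h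
    have hgi (i : ℕ) (hi : i < m) : g ⟨i, by omega⟩ = D ((T ^ i) y) := by
      rw [hg, aeval_cyclicShiftL_apply, hy, aeval_eq_sum_range]
      simp only [sum_apply, smul_apply, map_sum, map_smul]
      refine Finset.sum_congr rfl fun k hk => ?_
      rw [← mul_apply_eq_comp (T ^ i), ← pow_add]
      rw [Finset.mem_range] at hk
      have : ((⟨i, by omega⟩ + Fin.ofNat (n + 1) k : Fin (n + 1)) : ℕ) = i + k := by
        rw [Fin.val_add, Fin.val_ofNat, Nat.mod_eq_of_lt (a := k) (by omega),
          Nat.mod_eq_of_lt (by simp; omega)]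
      change _ • D ((T ^ _) x) = _
      rw [this]
    calc ‖y‖ ^ 2 - ‖(T ^ m) y‖ ^ 2 = ∑ i ∈ Finset.range m, ‖D ((T ^ i) y)‖ ^ 2 := (hsum y m).symm
      _ = ∑ i : Fin m, ‖g (Fin.castLE (by omega) i)‖ ^ 2 := by
        rw [← Fin.sum_univ_eq_sum_range (fun i => ‖D ((T ^ i) y)‖ ^ 2)]
        refine Finset.sum_congr rfl fun i _ => ?_
        rw [← hgi i i.2]; rfl
      _ ≤ ∑ i : Fin (n + 1), ‖g i‖ ^ 2 := by
        rw [← Finset.sum_image (f := fun i => ‖g i‖ ^ 2) (Fin.castLE_injective _).injOn]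
        exact Finset.sum_le_sum_of_subset_of_nonneg (Finset.subset_univ _)
          fun _ _ _ => sq_nonneg _
      _ = ‖g‖ ^ 2 := (PiLp.norm_sq_eq_of_L2 _ g).symm
      _ ≤ (M * ‖h‖) ^ 2 := by gcongr
      _ ≤ (M * ‖x‖) ^ 2 := by rw [mul_pow, mul_pow]; gcongr
  -- Strict contractivity gives `T ^ m → 0`, which removes the truncation error.
  have hlim : Filter.Tendsto (fun m => ‖y‖ ^ 2 - ‖(T ^ m) y‖ ^ 2) Filter.atTop
      (nhds (‖y‖ ^ 2 - ‖(0 : E →L[ℂ] E) y‖ ^ 2)) := by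
    have h0 : Filter.Tendsto (fun m => (T ^ m) y) Filter.atTop (nhds ((0 : E →L[ℂ] E) y)) :=
      ((ContinuousLinearMap.apply ℂ E y).continuous.tendsto _).comp
        (tendsto_pow_atTop_nhds_zero_of_norm_lt_one hT)
    exact (h0.norm.pow 2).const_sub _
  have hle := le_of_tendsto' hlim hbound
  refine le_of_sq_le_sq ?_ (by positivity)
  simpa using hle

end VonNeumann

/-! ### Orthogonality relations for unitary pencils. -/

section UnitaryPencil

variable {R : Type*} [Ring R] [StarRing R] [Algebra ℂ R] [StarModule ℂ R]

/-- Expanding gives a trigonometric polynomial in `ζ` that vanishes on the circle; its Fourier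
coefficients vanish. Weighting the values at the fourth roots of unity by `ζ` isolates `star a * b`.
-/
theorem star_mul_eq_zero_of_forall_star_mul_self {a b : R}
    (h : ∀ ζ : ℂ, ‖ζ‖ = 1 → star (ζ • a + b) * (ζ • a + b) = 1) : star a * b = 0 := by
  have e (ζ : ℂ) (hζ : ‖ζ‖ = 1) : star a * a + star b * b - 1 +
      (star ζ • (star a * b) + ζ • (star b * a)) = 0 := by
    have h1 := h ζ hζ
    have h2 : star ζ * ζ = 1 := by
      rw [Complex.star_def, ← Complex.normSq_eq_conj_mul_self, Complex.normSq_eq_norm_sq, hζ]; simp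
    rw [star_add, star_smul, add_mul, mul_add, mul_add, smul_mul_smul_comm, h2, one_smul,
      smul_mul_assoc, mul_smul_comm] at h1
    rw [← sub_eq_zero] at h1
    rw [← h1]; abel
  have e1 := e 1 (by simp)
  have e2 := e (-1) (by simp)
  have e3 := e Complex.I (by simp)
  have e4 := e (-Complex.I) (by simp)
  have h4 : (4 : ℂ) • (star a * b) = 0 := by
    have : (4 : ℂ) • (star a * b) = (1 : ℂ) • 0 - (1 : ℂ) • 0 + Complex.I • 0 - Complex.I • 0 := by
      nth_rw 1 [← e1]
      nth_rw 1 [← e2]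
      nth_rw 1 [← e3]
      nth_rw 1 [← e4]
      have hI : Complex.I * Complex.I = -1 := Complex.I_mul_I
      simp only [Complex.star_def, map_neg, map_one, Complex.conj_I, neg_neg]
      match_scalars <;> norm_num
    simpa using this
  exact (smul_eq_zero.mp h4).resolve_left (by norm_num)

end UnitaryPencil

section
variable {X : Type*} [NormedAddCommGroup X] [InnerProductSpace ℂ X] {N : ℕ}
  {a : Fin N → X →L[ℂ] X}

theorem pencil_update (ζ : Fin N → ℂ) (k : Fin N) (c : ℂ) :
    pencil (Function.update ζ k c) a = c • a k + pencil (Function.update ζ k 0) a := by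
  simp only [pencil]
  rw [← Finset.add_sum_erase _ _ (Finset.mem_univ k),
    ← Finset.add_sum_erase (a := k) _ (fun i => Function.update ζ k 0 i • a i) (Finset.mem_univ k)]
  simp only [Function.update_self, zero_smul, zero_add]
  congr 1
  refine Finset.sum_congr rfl fun i hi => ?_
  rw [Function.update_of_ne (Finset.ne_of_mem_erase hi),
    Function.update_of_ne (Finset.ne_of_mem_erase hi)]

variable [CompleteSpace X]

/-- Varying `ζ k` alone shows that `star (a k)` annihilates the rest of the pencil; subtracting the
cases `ζ j = 1` and `ζ j = -1` leaves only the `j`-th term. -/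
theorem star_mul_eq_zero_of_pencil_mem_unitary
    (h : ∀ ζ : Fin N → ℂ, (∀ k, ‖ζ k‖ = 1) → pencil ζ a ∈ unitary (X →L[ℂ] X))
    {k j : Fin N} (hkj : k ≠ j) : star (a k) * a j = 0 := by
  have h1 (c : ℂ) (hc : ‖c‖ = 1) :
      star (a k) * pencil (Function.update (Function.update 1 j c) k 0) a = 0 := by
    refine star_mul_eq_zero_of_forall_star_mul_self fun ζ hζ => ?_
    rw [← pencil_update]
    refine Unitary.star_mul_self_of_mem (h _ fun i => ?_)
    simp only [Function.update_apply]
    split_ifs <;> simp [*]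
  have h2 (c : ℂ) (hc : ‖c‖ = 1) := by
    have := h1 c hc
    rwa [Function.update_comm hkj.symm, pencil_update, mul_add, mul_smul_comm] at this
  have e1 := h2 1 (by simp)
  have e2 := h2 (-1) (by simp)
  have h4 : (2 : ℂ) • (star (a k) * a j) = 0 := by
    have : (2 : ℂ) • (star (a k) * a j) = 0 - 0 := by
      nth_rw 1 [← e1]
      nth_rw 1 [← e2]
      module
    simpa using this
  exact (smul_eq_zero.mp h4).resolve_left (by norm_num)

theorem sum_star_mul_self_of_pencil_mem_unitary
    (h : ∀ ζ : Fin N → ℂ, (∀ k, ‖ζ k‖ = 1) → pencil ζ a ∈ unitary (X →L[ℂ] X)) :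
    ∑ k, star (a k) * a k = 1 := by
  have h1 := Unitary.star_mul_self_of_mem (h 1 (by simp))
  simp only [pencil, Pi.one_apply, one_smul, star_sum, Finset.sum_mul_sum] at h1
  rw [← h1]
  refine Finset.sum_congr rfl fun k _ => ?_
  rw [Finset.sum_eq_single k (fun j _ hj => star_mul_eq_zero_of_pencil_mem_unitary h hj.symm)
    (by simp)]

end

/-! ### Noncommutative words and their commutative content. -/

section Words

variable {N n : ℕ}

theorem sum_pow_eq_sum_words {R : Type*} [Ring R] [Algebra ℂ R] (a : Fin N → R) (n : ℕ) :
    (∑ k, a k) ^ n = ∑ f : Fin n → Fin N, (List.ofFn fun i => a (f i)).prod := by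
  have := (MultilinearMap.mkPiAlgebraFin ℂ n R).map_sum (fun _ => a)
  simpa only [MultilinearMap.mkPiAlgebraFin_apply, List.ofFn_const, List.prod_replicate] using this

theorem prod_ofFn_smul {R : Type*} [Ring R] [Algebra ℂ R] (z : Fin n → ℂ) (a : Fin n → R) :
    (List.ofFn fun i => z i • a i).prod = (∏ i, z i) • (List.ofFn a).prod := by
  have := (MultilinearMap.mkPiAlgebraFin ℂ n R).map_smul_univ z a
  simpa only [MultilinearMap.mkPiAlgebraFin_apply] using this

/-- The content of a word: the multiset of its letters. -/
def wordContent (f : Fin n → Fin N) : Multiset (Fin N) := List.ofFn f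

theorem prod_ofFn_eq_of_wordContent_eq {R : Type*} [Monoid R] {c : Fin N → R}
    (hc : ∀ k j, c k * c j = c j * c k) {f g : Fin n → Fin N}
    (hfg : wordContent f = wordContent g) :
    (List.ofFn fun i => c (f i)).prod = (List.ofFn fun i => c (g i)).prod := by
  have hp : (List.ofFn f).Perm (List.ofFn g) := Quotient.exact hfg
  have hp' := hp.map c
  rw [List.map_ofFn, List.map_ofFn] at hp'
  refine hp'.prod_eq' ?_
  rw [List.pairwise_ofFn]
  intro i j _
  exact hc _ _

/-- Linear functionals separate points, so the claim reduces to scalars, where a polynomial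
vanishing on all of `ℂ ^ N` has zero coefficients. -/
theorem sum_wordContent_eq_zero {E : Type*} [AddCommGroup E] [Module ℂ E]
    {w : (Fin n → Fin N) → E} (hw : ∀ z : Fin N → ℂ, ∑ f, (∏ i, z (f i)) • w f = 0)
    (t : Multiset (Fin N)) : ∑ f with wordContent f = t, w f = 0 := by
  rw [← Module.forall_dual_apply_eq_zero_iff ℂ]
  intro φ
  let P : MvPolynomial (Fin N) ℂ :=
    ∑ f, MvPolynomial.monomial (Multiset.toFinsupp (wordContent f)) (φ (w f))
  have hP : P = 0 := by
    refine MvPolynomial.funext fun z => ?_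
    have := congrArg φ (hw z)
    simp only [map_sum, map_smul, map_zero, smul_eq_mul] at this
    simp only [P, map_sum, map_zero]
    rw [← this]
    refine Finset.sum_congr rfl fun f _ => ?_
    rw [MvPolynomial.eval_monomial, mul_comm]
    congr 1
    rw [Finsupp.prod, Multiset.toFinsupp_support]
    simp only [Multiset.toFinsupp_apply]
    rw [← Finset.prod_multiset_map_count, wordContent, Multiset.map_coe, Multiset.prod_coe,
      List.map_ofFn, List.prod_ofFn]
    rfl
  have hc := congrArg (MvPolynomial.coeff (Multiset.toFinsupp t)) hP
  simp only [P, MvPolynomial.coeff_sum, MvPolynomial.coeff_monomial, MvPolynomial.coeff_zero,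
    EmbeddingLike.apply_eq_iff_eq] at hc
  rw [map_sum, Finset.sum_filter]
  exact hc

theorem sum_words_eq_zero {E F G : Type*} [AddCommGroup E] [Module ℂ E] [AddCommGroup F]
    [Module ℂ F] [AddCommGroup G] [Module ℂ G] (B : E →ₗ[ℂ] F →ₗ[ℂ] G)
    {w : (Fin n → Fin N) → E} (hw : ∀ z : Fin N → ℂ, ∑ f, (∏ i, z (f i)) • w f = 0)
    {c : (Fin n → Fin N) → F} (hc : ∀ f g, wordContent f = wordContent g → c f = c g) :
    ∑ f, B (w f) (c f) = 0 := by
  rw [← Finset.sum_fiberwise_of_maps_to (t := Finset.univ.image wordContent) (g := wordContent)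
    (fun f _ => Finset.mem_image_of_mem _ (Finset.mem_univ f))]
  refine Finset.sum_eq_zero fun t ht => ?_
  obtain ⟨g, -, rfl⟩ := Finset.mem_image.mp ht
  have : ∀ f ∈ Finset.univ.filter (fun f => wordContent f = wordContent g),
      B (w f) (c f) = B (w f) (c g) := fun f hf => by
    rw [hc f g (Finset.mem_filter.mp hf).2]
  rw [Finset.sum_congr rfl this, ← LinearMap.sum_apply, ← map_sum, sum_wordContent_eq_zero hw]
  simp

end Words

/-! ### Operators on the Hilbert space tensor product. -/

section HilbertTensor

open UniformSpace ContinuousLinearMap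

variable {X X' X'' H H' H'' : Type*}
  [NormedAddCommGroup X] [InnerProductSpace ℂ X] [NormedAddCommGroup H] [InnerProductSpace ℂ H]
  [NormedAddCommGroup X'] [InnerProductSpace ℂ X'] [NormedAddCommGroup H'] [InnerProductSpace ℂ H']
  [NormedAddCommGroup X''] [InnerProductSpace ℂ X'']
  [NormedAddCommGroup H''] [InnerProductSpace ℂ H'']

/-- The bounded operator `a ⊗ c` between Hilbert space tensor products. -/
noncomputable def hilbertMap (a : X →L[ℂ] X') (c : H →L[ℂ] H') :
    HilbertTensor X H →L[ℂ] HilbertTensor X' H' :=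
  (TensorProduct.mapL a c).completion

@[simp]
theorem hilbertMap_coe (a : X →L[ℂ] X') (c : H →L[ℂ] H') (x : X ⊗[ℂ] H) :
    hilbertMap a c (x : HilbertTensor X H) = (TensorProduct.mapL a c x : X' ⊗[ℂ] H') :=
  completion_apply_coe _ _

theorem hilbertTensor_ext {G : Type*} [NormedAddCommGroup G] [NormedSpace ℂ G]
    {S T : HilbertTensor X H →L[ℂ] G} (h : ∀ x : X ⊗[ℂ] H, S x = T x) : S = T :=
  ContinuousLinearMap.ext fun y =>
    Completion.induction_on y (isClosed_eq S.continuous T.continuous) h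

theorem hilbertMap_comp (a : X' →L[ℂ] X'') (c : H' →L[ℂ] H'') (a' : X →L[ℂ] X')
    (c' : H →L[ℂ] H') : hilbertMap a c ∘L hilbertMap a' c' = hilbertMap (a ∘L a') (c ∘L c') :=
  hilbertTensor_ext fun x => by
    rw [comp_apply, hilbertMap_coe, hilbertMap_coe, hilbertMap_coe, TensorProduct.mapL_comp]; rfl

theorem hilbertMap_mul (a a' : X →L[ℂ] X) (c c' : H →L[ℂ] H) :
    hilbertMap a c * hilbertMap a' c' = hilbertMap (a * a') (c * c') :=
  hilbertMap_comp a c a' c'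

theorem hilbertMap_one : hilbertMap (1 : X →L[ℂ] X) (1 : H →L[ℂ] H) = 1 :=
  hilbertTensor_ext fun x => by
    rw [hilbertMap_coe]
    exact congrArg _ (DFunLike.congr_fun TensorProduct.mapL_id_id x)

/-- `hilbertMap` as a bilinear map. -/
noncomputable def hilbertMapₗ (X X' H H' : Type*)
    [NormedAddCommGroup X] [InnerProductSpace ℂ X] [NormedAddCommGroup H] [InnerProductSpace ℂ H]
    [NormedAddCommGroup X'] [InnerProductSpace ℂ X']
    [NormedAddCommGroup H'] [InnerProductSpace ℂ H'] :
    (X →L[ℂ] X') →ₗ[ℂ] (H →L[ℂ] H') →ₗ[ℂ] (HilbertTensor X H →L[ℂ] HilbertTensor X' H') :=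
  LinearMap.mk₂ ℂ hilbertMap
    (fun a a' c => hilbertTensor_ext fun x => by
      simp [TensorProduct.map_add_left, Completion.coe_add])
    (fun r a c => hilbertTensor_ext fun x => by
      simp [TensorProduct.map_smul_left, Completion.coe_smul])
    (fun a c c' => hilbertTensor_ext fun x => by
      simp [TensorProduct.map_add_right, Completion.coe_add])
    (fun r a c => hilbertTensor_ext fun x => by
      simp [TensorProduct.map_smul_right, Completion.coe_smul])

@[simp]
theorem hilbertMapₗ_apply (a : X →L[ℂ] X') (c : H →L[ℂ] H') :
    hilbertMapₗ X X' H H' a c = hilbertMap a c := rfl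

theorem norm_hilbertMap_le (a : X →L[ℂ] X') (c : H →L[ℂ] H') :
    ‖hilbertMap a c‖ ≤ ‖a‖ * ‖c‖ := by
  refine opNorm_le_bound _ (by positivity) fun y => ?_
  induction y using Completion.induction_on with
  | hp => exact isClosed_le (by fun_prop) (by fun_prop)
  | ih x =>
    rw [hilbertMap_coe, Completion.norm_coe, Completion.norm_coe]
    exact le_of_opNorm_le _ (TensorProduct.norm_mapL_le a c) x

theorem adjoint_hilbertMap [CompleteSpace X] [CompleteSpace X'] [CompleteSpace H] [CompleteSpace H']
    (a : X →L[ℂ] X') (c : H →L[ℂ] H') :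
    adjoint (hilbertMap a c) = hilbertMap (adjoint a) (adjoint c) := by
  symm
  rw [eq_adjoint_iff]
  intro x y
  induction x, y using Completion.induction_on₂ with
  | hp => exact isClosed_eq (by fun_prop) (by fun_prop)
  | ih x y =>
    rw [hilbertMap_coe, hilbertMap_coe, Completion.inner_coe, Completion.inner_coe]
    induction x using TensorProduct.induction_on with
    | zero => simp
    | add x x' hx hx' => rw [map_add, inner_add_left, inner_add_left, hx, hx']
    | tmul x h =>
      induction y using TensorProduct.induction_on with
      | zero => simp
      | add y y' hy hy' => rw [map_add, inner_add_right, inner_add_right, hy, hy']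
      | tmul y k =>
        rw [TensorProduct.mapL_tmul, TensorProduct.mapL_tmul, TensorProduct.inner_tmul,
          TensorProduct.inner_tmul, adjoint_inner_left, adjoint_inner_left]

theorem tensorTuple_eq_sum {N : ℕ} (A : Fin N → X →L[ℂ] X) (C : Fin N → H →L[ℂ] H) :
    tensorTuple A C = ∑ k, hilbertMap (A k) (C k) := rfl

/-- Pythagoras applies to the orthogonal summands; `‖C‖` is the sup norm of the tuple. -/
theorem norm_tensorTuple_le [CompleteSpace X] [CompleteSpace H] {N : ℕ}
    {A : Fin N → X →L[ℂ] X} (hA : ∀ k j, k ≠ j → star (A k) * A j = 0)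
    (hA' : ∑ k, star (A k) * A k = 1) (C : Fin N → H →L[ℂ] H) : ‖tensorTuple A C‖ ≤ ‖C‖ := by
  refine opNorm_le_bound _ (norm_nonneg _) fun x => ?_
  have hinner (k j : Fin N) : inner ℂ (hilbertMap (A k) (C k) x) (hilbertMap (A j) (C j) x) =
      inner ℂ x (hilbertMap (star (A k) * A j) (star (C k) * C j) x) := by
    rw [← adjoint_inner_right, adjoint_hilbertMap, ← comp_apply, hilbertMap_comp]; rfl
  have h1 : ‖tensorTuple A C x‖ ^ 2 = ∑ k, ‖hilbertMap (A k) (C k) x‖ ^ 2 := by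
    rw [← inner_self_eq_norm_sq (𝕜 := ℂ), tensorTuple_eq_sum, sum_apply, sum_inner, map_sum]
    refine Finset.sum_congr rfl fun k _ => ?_
    rw [inner_sum, Finset.sum_eq_single k, inner_self_eq_norm_sq]
    · intro j _ hj
      rw [hinner, hA k j hj.symm, ← hilbertMapₗ_apply]
      simp
    · simp
  have h2 : ∑ k, ‖hilbertMap (A k) (1 : H →L[ℂ] H) x‖ ^ 2 = ‖x‖ ^ 2 := by
    have h (k : Fin N) : ‖hilbertMap (A k) (1 : H →L[ℂ] H) x‖ ^ 2 =
        RCLike.re (inner ℂ x (hilbertMap (star (A k) * A k) (1 : H →L[ℂ] H) x)) := by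
      rw [← inner_self_eq_norm_sq (𝕜 := ℂ), ← adjoint_inner_right, adjoint_hilbertMap,
        ← comp_apply, hilbertMap_comp]
      have : adjoint (1 : H →L[ℂ] H) ∘L (1 : H →L[ℂ] H) = 1 := by
        rw [← star_eq_adjoint, star_one]; rfl
      rw [this]; rfl
    simp only [h]
    rw [← map_sum, ← inner_sum, ← sum_apply]
    simp only [← hilbertMapₗ_apply]
    rw [← LinearMap.sum_apply, ← map_sum, hA', hilbertMapₗ_apply, hilbertMap_one,
      one_apply_eq_self, inner_self_eq_norm_sq]
  -- Factor `A k ⊗ C k = (1 ⊗ C k) (A k ⊗ 1)`, so that only `‖C k‖` is lost.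
  have h3 (k : Fin N) : ‖hilbertMap (A k) (C k) x‖ ≤ ‖C‖ * ‖hilbertMap (A k) (1 : H →L[ℂ] H) x‖ := by
    have : hilbertMap (A k) (C k) = hilbertMap (1 : X →L[ℂ] X) (C k) ∘L hilbertMap (A k) 1 := by
      rw [hilbertMap_comp]; rfl
    rw [this, comp_apply]
    refine le_of_opNorm_le _ ((norm_hilbertMap_le _ _).trans ?_) _
    calc ‖(1 : X →L[ℂ] X)‖ * ‖C k‖ ≤ 1 * ‖C‖ := by
          gcongr
          · exact norm_id_le
          · exact norm_le_pi_norm C k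
      _ = ‖C‖ := one_mul _
  refine le_of_sq_le_sq ?_ (by positivity)
  rw [h1, mul_pow, ← h2, Finset.mul_sum]
  refine Finset.sum_le_sum fun k _ => ?_
  rw [← mul_pow]
  gcongr
  exact h3 k

theorem tensorTuple_pow {N : ℕ} (A : Fin N → X →L[ℂ] X) (C : Fin N → H →L[ℂ] H) (n : ℕ) :
    tensorTuple A C ^ n = ∑ f : Fin n → Fin N,
      hilbertMap (List.ofFn fun i => A (f i)).prod (List.ofFn fun i => C (f i)).prod := by
  have hprod (m : ℕ) (f : Fin m → Fin N) :
      (List.ofFn fun i => hilbertMap (A (f i)) (C (f i))).prod =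
        hilbertMap (List.ofFn fun i => A (f i)).prod (List.ofFn fun i => C (f i)).prod := by
    induction m with
    | zero => simp [hilbertMap_one]
    | succ m ih => simp only [List.ofFn_succ, List.prod_cons, ih (fun i => f i.succ), hilbertMap_mul]
  rw [tensorTuple_eq_sum, sum_pow_eq_sum_words]
  exact Finset.sum_congr rfl fun f _ => hprod n f

theorem pencil_pow {N : ℕ} (z : Fin N → ℂ) (A : Fin N → X →L[ℂ] X) (n : ℕ) :
    pencil z A ^ n =
      ∑ f : Fin n → Fin N, (∏ i, z (f i)) • (List.ofFn fun i => A (f i)).prod := by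
  rw [pencil, sum_pow_eq_sum_words]
  exact Finset.sum_congr rfl fun f _ => prod_ofFn_smul _ _

/-- A `ρ`-dilation of all the pencils passes to the tensor products with a commuting tuple. -/
theorem tensorTuple_pow_eq_of_dilation {Xt : Type*} [NormedAddCommGroup Xt]
    [InnerProductSpace ℂ Xt] [CompleteSpace X] [CompleteSpace Xt] {N : ℕ} {ρ : ℝ}
    {V : X →ₗᵢ[ℂ] Xt} {At : Fin N → Xt →L[ℂ] Xt} {A : Fin N → X →L[ℂ] X}
    (h : ∀ z : Fin N → ℂ, IsRhoDilation ρ V (pencil z At) (pencil z A))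
    {C : Fin N → H →L[ℂ] H} (hC : ∀ k j, C k * C j = C j * C k) {n : ℕ} (hn : 1 ≤ n) :
    tensorTuple A C ^ n = (ρ : ℂ) • (hilbertMap (adjoint V.toContinuousLinearMap) (.id ℂ H) ∘L
      (tensorTuple At C ^ n) ∘L hilbertMap V.toContinuousLinearMap (.id ℂ H)) := by
  set Φ : (Xt →L[ℂ] Xt) → (X →L[ℂ] X) := fun S =>
    (ρ : ℂ) • (adjoint V.toContinuousLinearMap ∘L S ∘L V.toContinuousLinearMap) with hΦ
  -- The dilation identity says nothing about single words, only about these sums over all words,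
  -- for every `z`.
  have hw (z : Fin N → ℂ) : ∑ f : Fin n → Fin N, (∏ i, z (f i)) •
      ((List.ofFn fun i => A (f i)).prod - Φ (List.ofFn fun i => At (f i)).prod) = 0 := by
    have h1 := h z n hn
    rw [pencil_pow, pencil_pow] at h1
    simp only [smul_sub, Finset.sum_sub_distrib]
    rw [h1, sub_eq_zero, hΦ, finsetSum_comp, comp_finsetSum, Finset.smul_sum]
    refine Finset.sum_congr rfl fun f _ => ?_
    rw [smul_comp, comp_smul, smul_comm]
  have h2 := sum_words_eq_zero (hilbertMapₗ X X H H) hw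
    (c := fun f => (List.ofFn fun i => C (f i)).prod)
    (fun f g hfg => prod_ofFn_eq_of_wordContent_eq hC hfg)
  simp only [map_sub, LinearMap.sub_apply, Finset.sum_sub_distrib, sub_eq_zero] at h2
  simp only [hilbertMapₗ_apply, ← tensorTuple_pow] at h2
  rw [h2, tensorTuple_pow, finsetSum_comp, comp_finsetSum, Finset.smul_sum]
  refine Finset.sum_congr rfl fun f _ => ?_
  rw [hilbertMap_comp, hilbertMap_comp, ← hilbertMapₗ_apply, hΦ, map_smul, LinearMap.smul_apply]
  rfl

end HilbertTensor


/-! ### Polynomials of the tensor tuple and the final bound. -/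

section

open Polynomial ContinuousLinearMap

theorem aeval_tensorTuple_eq_of_dilation {X Xt H : Type*}
    [NormedAddCommGroup X] [InnerProductSpace ℂ X] [CompleteSpace X]
    [NormedAddCommGroup Xt] [InnerProductSpace ℂ Xt] [CompleteSpace Xt]
    [NormedAddCommGroup H] [InnerProductSpace ℂ H] {N : ℕ} {ρ : ℝ}
    {V : X →ₗᵢ[ℂ] Xt} {At : Fin N → Xt →L[ℂ] Xt} {A : Fin N → X →L[ℂ] X}
    (h : ∀ z : Fin N → ℂ, IsRhoDilation ρ V (pencil z At) (pencil z A))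
    {C : Fin N → H →L[ℂ] H} (hC : ∀ k j, C k * C j = C j * C k) (p : ℂ[X]) :
    aeval (tensorTuple A C) p = hilbertMap (adjoint V.toContinuousLinearMap) (.id ℂ H) ∘L
      aeval (tensorTuple At C) (Polynomial.C (ρ : ℂ) * p + Polynomial.C ((1 - ρ) * p.eval 0)) ∘L
        hilbertMap V.toContinuousLinearMap (.id ℂ H) := by
  have hV : hilbertMap (adjoint V.toContinuousLinearMap) (.id ℂ H) ∘L
      hilbertMap V.toContinuousLinearMap (.id ℂ H) = 1 := by
    rw [hilbertMap_comp, ← hilbertMap_one]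
    congr 1
    exact (norm_map_iff_adjoint_comp_self _).mp V.norm_map
  induction p using Polynomial.induction_on' with
  | add p q hp hq =>
    rw [map_add, hp, hq, ← comp_add, ← ContinuousLinearMap.add_comp, ← map_add]
    congr 3
    simp only [eval_add, mul_add, Polynomial.C_add]
    ring
  | monomial n c =>
    rcases Nat.eq_zero_or_pos n with rfl | hn
    -- The power `n = 0` compresses to the identity without the factor `ρ`; the term `(1 - ρ) p(0)`
    -- compensates.
    · have : Polynomial.C (ρ : ℂ) * monomial 0 c +
          Polynomial.C ((1 - ρ) * (monomial 0 c).eval 0) = Polynomial.C c := by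
        rw [monomial_zero_left, eval_C, ← Polynomial.C_mul, ← Polynomial.C_add]
        congr 1; ring
      rw [this, monomial_zero_left, aeval_C, aeval_C, Algebra.algebraMap_eq_smul_one,
        Algebra.algebraMap_eq_smul_one, ContinuousLinearMap.smul_comp, comp_smul]
      exact congrArg _ hV.symm
    · rw [eval_monomial, zero_pow hn.ne', mul_zero, mul_zero, Polynomial.C_0, add_zero, map_mul,
        aeval_C, aeval_monomial, aeval_monomial, Algebra.algebraMap_eq_smul_one,
        Algebra.algebraMap_eq_smul_one, smul_one_mul, smul_one_mul,
        tensorTuple_pow_eq_of_dilation h hC hn, Algebra.algebraMap_eq_smul_one, smul_one_mul]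
      simp only [ContinuousLinearMap.smul_comp, ContinuousLinearMap.comp_smul]
      rw [smul_comm]

end

theorem mainTheorem9 {X : Type u} {H : Type w}
    [NormedAddCommGroup X] [InnerProductSpace ℂ X] [CompleteSpace X]
    [NormedAddCommGroup H] [InnerProductSpace ℂ H] [CompleteSpace H]
    {N : ℕ} (ρ : ℝ) (hρ : 0 < ρ)
    (A : Fin N → X →L[ℂ] X) (hA : MemRhoClass.{u, v} ρ A)
    (C : Fin N → H →L[ℂ] H) (hC : IsCommutingStrictContraction C)
    (p : Polynomial ℂ) :
    ∃ M : ℝ,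
      IsGreatest ((fun z : ℂ => ‖(ρ : ℂ) * p.eval z + (1 - (ρ : ℂ)) * p.eval 0‖) ''
        Metric.closedBall 0 1) M ∧
      ‖Polynomial.aeval (tensorTuple A C) p‖ ≤ M := by
  obtain ⟨M, hM⟩ := ((isCompact_closedBall (0 : ℂ) 1).image
    (f := fun z : ℂ => ‖(ρ : ℂ) * p.eval z + (1 - (ρ : ℂ)) * p.eval 0‖)
    (by fun_prop)).exists_isGreatest ⟨_, 0, by simp, rfl⟩
  refine ⟨M, hM, ?_⟩
  obtain ⟨Xt, _, _, _, V, At, hdil, huni⟩ := hA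
  rw [aeval_tensorTuple_eq_of_dilation hdil hC.comm]
  have hlt : ‖tensorTuple At C‖ < 1 :=
    (norm_tensorTuple_le (fun _ _ => star_mul_eq_zero_of_pencil_mem_unitary huni)
      (sum_star_mul_self_of_pencil_mem_unitary huni) C).trans_lt
      ((pi_norm_lt_iff one_pos).mpr hC.norm_lt_one)
  have hvn := norm_aeval_le_of_norm_lt_one (M := M)
    (q := Polynomial.C (ρ : ℂ) * p + Polynomial.C ((1 - ρ) * p.eval 0)) hlt fun z hz => by
      refine hM.2 ⟨z, by simpa using hz, ?_⟩
      simp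
  have hid : ‖ContinuousLinearMap.id ℂ H‖ ≤ 1 := ContinuousLinearMap.norm_id_le
  have hV : ‖V.toContinuousLinearMap‖ ≤ 1 := V.norm_toContinuousLinearMap_le
  have h1 : ‖hilbertMap V.toContinuousLinearMap (.id ℂ H)‖ ≤ 1 :=
    (norm_hilbertMap_le _ _).trans (mul_le_one₀ hV (norm_nonneg _) hid)
  have h2 : ‖hilbertMap (ContinuousLinearMap.adjoint V.toContinuousLinearMap) (.id ℂ H)‖ ≤ 1 :=
    (norm_hilbertMap_le _ _).trans (mul_le_one₀
      ((LinearIsometryEquiv.norm_map ContinuousLinearMap.adjoint _).trans_le hV) (norm_nonneg _) hid)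
  refine (ContinuousLinearMap.opNorm_comp_le _ _).trans ?_
  refine (mul_le_of_le_one_left (norm_nonneg _) h2).trans ?_
  refine (ContinuousLinearMap.opNorm_comp_le _ _).trans ?_
  exact (mul_le_of_le_one_right (norm_nonneg _) h1).trans hvn
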